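/- An \emph{$\omega$-continuous semiring} $(\mathcal S,\le)$ is a (not necessarily commutative) semiring $(S,\oplus,\otimes,0,1)$ with an $\omega$-complete partial order $\le$ whose least element is $0$, such that $\oplus$ and $\otimes$ are monotone and $\omega$-continuous in each argument; countable sums are suprema of finite partial sums. It is \emph{computable} if $S$ is (identified, via a fixed numbering, with) a computable set of natural numbers, the operations $\oplus$, $\otimes$ and $s\mapsto s^*=\bigoplus_{n\in\mathbb N}s^n$ are computable, and $\le$ is decidable. Fix a finite set of fields $f$ and a finite set of values $v$. A \emph{packet} $\pi\in\mathsf{Pk}$ assigns a value to each field; a \emph{history} $h\in\mathsf H$ is a non-empty list $\pi::\hbar$ of packets. \emph{Predicates} are $t,u::=\mathsf{false}\mid\mathsf{true}\mid f=v\mid t\vee u\mid t\wedge u\mid\neg t$, with their usual Boolean meaning on packets, and \emph{policies} over $\mathcal S$ are $$p,q::=t\mid f\leftarrow v\mid\mathsf{dup}\mid p\,;q\mid r\odot p\mid p\oplus q\mid p^{\ast}\qquad(r\in S).$$ Writing $[P]=1$ if $P$ holds and $[P]=0$ otherwise, and $\eta(h)(h')=[h=h']$, the semantics $\llbracket p\rrbracket:\mathsf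 H\to(\mathsf H\to S)$ is given by $\llbracket t\rrbracket(\pi::\hbar)=[\pi\text{ satisfies }t]\otimes\eta(\pi::\hbar)$, $\llbracket f\leftarrow v\rrbracket(\pi::\hbar)=\eta(\pi[f\leftarrow v]::\hbar)$, $\llbracket\mathsf{dup}\rrbracket(\pi::\hbar)=\eta(\pi::\pi::\hbar)$, $\llbracket p\,;q\rrbracket(h)(h')=\bigoplus_{h''}\llbracket p\rrbracket(h)(h'')\otimes\llbracket q\rrbracket(h'')(h')$, the sum being over all $h''$ with $\llbracket p\rrbracket(h)(h'')\neq0$, $\llbracket r\odot p\rrbracket(h)(h')=r\otimes\llbracket p\rrbracket(h)(h')$, $\llbracket p\oplus q\rrbracket(h)(h')=\llbracket p\rrbracket(h)(h')\oplus\llbracket q\rrbracket(h)(h')$, and $\llbracket p^{\ast}\rrbracket(h)(h')=\bigoplus_{i\in\mathbb N}\llbracket p^i\rrbracket(h)(h')$, where $p^0=\mathsf{true}$ and $p^{i+1}=p\,;p^i$. A policy $p$ is \emph{$r$-reachable} if there are $\pi\in\mathsf{Pk}$ and $h\in\mathsf H$ with $\llbracket p\rrbracket(\pi::\langle\rangle)(h)\ge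 r$. \textbf{Theorem (Decidability of $r$-reachability).} Let $(\mathcal S,\le)$ be a computable $\omega$-continuous semiring such that for all $s_1,s_2,s_3\in S$ we have $s_1\ge s_1\otimes s_2$, and $s_1\oplus s_2\ge s_3$ if and only if $s_1\ge s_3$ or $s_2\ge s_3$. Then it is decidable, given a policy $p$ over $\mathcal S$ and a weight $r\in S$, whether $p$ is $r$-reachable. Moreover, there is an algorithm that, given $p$ and $r$ such that $p$ is $r$-reachable, computes a witness, i.e. $\pi\in\mathsf{Pk}$ and $h\in\mathsf H$ with $\llbracket p\rrbracket(\pi::\langle\rangle)(h)\ge r$. -/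

import Mathlib

namespace WNetKAT

/-! ### ω-continuous semirings -/

/-- An `ω`-continuous semiring: a (not necessarily commutative) semiring carrying an `ω`-complete
partial order with least element `0`, for which addition and multiplication are monotone and
`ω`-continuous in each argument. (`ωScottContinuous` includes monotonicity; addition is
commutative, so one argument suffices there.) -/
class OmegaContinuousSemiring (S : Type*) extends Semiring S, OmegaCompletePartialOrder S where
  zero_least : ∀ s : S, 0 ≤ s
  add_continuous : ∀ s : S, OmegaCompletePartialOrder.ωScottContinuous (fun x : S => s + x)
  mul_left_continuous : ∀ s : S, OmegaCompletePartialOrder.ωScottContinuous (fun x : S => s * x)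
  mul_right_continuous : ∀ s : S, OmegaCompletePartialOrder.ωScottContinuous (fun x : S => x * s)

section Sums

variable {S : Type*} [OmegaContinuousSemiring S]

theorem le_add_self_right (a b : S) : a ≤ a + b := by
  have h := (OmegaContinuousSemiring.add_continuous a).monotone
    (OmegaContinuousSemiring.zero_least b)
  simpa using h

/-- The chain of partial sums `∑_{j < n} f (enum j)` of a countable family, along an enumeration of
the index set in which each index occurs exactly once (numbers `j` that enumerate nothing contribute
`0`). -/
noncomputable def partialSums {I : Type*} [Countable I] (f : I → S) :
    OmegaCompletePartialOrder.Chain S where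
  toFun n := ∑ j ∈ Finset.range n, (@Encodable.decode₂ I (Encodable.ofCountable I) j).elim 0 f
  monotone' := monotone_nat_of_le_succ fun n => by
    rw [Finset.sum_range_succ]
    exact le_add_self_right _ _

/-- Countable sums: the supremum of the partial sums. -/
noncomputable def csum {I : Type*} [Countable I] (f : I → S) : S :=
  OmegaCompletePartialOrder.ωSup (partialSums f)

/-- The closure operation `s* = ∑ₙ sⁿ`. -/
noncomputable def closure (s : S) : S := csum fun n : ℕ => s ^ n

/-- An `ω`-continuous semiring is computable with respect to a numbering `enc` of its elements:
`enc` identifies the domain with a computable set of natural numbers, under which addition,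
multiplication and closure are computable and the order is decidable. -/
structure IsComputable (enc : S → ℕ) : Prop where
  injective : Function.Injective enc
  domain : ComputablePred fun m : ℕ => m ∈ Set.range enc
  add : ∃ f : ℕ → ℕ → ℕ, Computable₂ f ∧ ∀ s t : S, f (enc s) (enc t) = enc (s + t)
  mul : ∃ f : ℕ → ℕ → ℕ, Computable₂ f ∧ ∀ s t : S, f (enc s) (enc t) = enc (s * t)
  star : ∃ f : ℕ → ℕ, Computable f ∧ ∀ s : S, f (enc s) = enc (closure s)
  order : ∃ f : ℕ → ℕ → Bool, Computable₂ f ∧ ∀ s t : S, f (enc s) (enc t) = true ↔ s ≤ t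

end Sums

/-! ### Syntax -/

/-- Packets: assignments of one of `n` values to each of `k` fields. -/
abbrev Packet (k n : ℕ) : Type := Fin k → Fin n

/-- Histories: non-empty lists of packets, as pairs of head packet and tail. -/
abbrev History (k n : ℕ) : Type := Packet k n × List (Packet k n)

/-- Predicates. -/
inductive Predicate (k n : ℕ) : Type
  | false : Predicate k n
  | true : Predicate k n
  | test : Fin k → Fin n → Predicate k n
  | or : Predicate k n → Predicate k n → Predicate k n
  | and : Predicate k n → Predicate k n → Predicate k n
  | not : Predicate k n → Predicate k n

/-- Policies with weights in `S`. -/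
inductive Policy (S : Type*) (k n : ℕ)
  | filter : Predicate k n → Policy S k n
  | modify : Fin k → Fin n → Policy S k n
  | dup : Policy S k n
  | seq : Policy S k n → Policy S k n → Policy S k n
  | weight : S → Policy S k n → Policy S k n
  | choice : Policy S k n → Policy S k n → Policy S k n
  | iter : Policy S k n → Policy S k n

/-! ### Denotational semantics -/

/-- Truth value of a predicate on a packet. -/
def Predicate.eval {k n : ℕ} : Predicate k n → Packet k n → Bool
  | .false, _ => Bool.false
  | .true, _ => Bool.true
  | .test f v, π => decide (π f = v)
  | .or t u, π => t.eval π || u.eval π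
  | .and t u, π => t.eval π && u.eval π
  | .not t, π => !(t.eval π)

section Semantics

variable {S : Type*} [OmegaContinuousSemiring S]

/-- Weightings over a countable type; their supports are automatically countable. -/
abbrev Weighting (S X : Type*) [Countable X] : Type _ := X → S

/-- The unit `η(x) = λ y. [x = y]`. -/
def Weighting.unit {X : Type*} [Countable X] [DecidableEq X] (x : X) : Weighting S X :=
  fun y => if x = y then 1 else 0

/-- The bind `m >>= f = λ y. ∑_{x ∈ supp m} m(x) * f(x)(y)`. -/
noncomputable def Weighting.bind {X : Type*} [Countable X] (m : Weighting S X)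
    (f : X → Weighting S X) : Weighting S X :=
  fun y => csum fun x : Function.support m => m x * f x y

/-- Iterated sequential composition of a map into weightings:
`f⁰ = η` (the semantics of `skip`) and `fⁱ⁺¹(h) = f(h) >>= fⁱ`. -/
noncomputable def Weighting.iterate {X : Type*} [Countable X] [DecidableEq X]
    (f : X → Weighting S X) : ℕ → X → Weighting S X
  | 0, h => Weighting.unit h
  | i + 1, h => (f h).bind (Weighting.iterate f i)

/-- The denotational semantics `⟦p⟧(h)(h')`. -/
noncomputable def Policy.denote {k n : ℕ} :
    Policy S k n → History k n → Weighting S (History k n)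
  | .filter t, h => fun h' => (if t.eval h.1 = true then 1 else 0) * Weighting.unit h h'
  | .modify f v, h => Weighting.unit (Function.update h.1 f v, h.2)
  | .dup, h => Weighting.unit (h.1, h.1 :: h.2)
  | .seq p q, h => (p.denote h).bind q.denote
  | .weight r p, h => fun h' => r * p.denote h h'
  | .choice p q, h => fun h' => p.denote h h' + q.denote h h'
  | .iter p, h => fun h' => csum fun i : ℕ => Weighting.iterate p.denote i h h'

/-- `p` is `r`-reachable: `⟦p⟧(π::⟨⟩)(h) ≥ r` for some packet `π` and history `h`. -/
def Policy.Reachable {k n : ℕ} (p : Policy S k n) (r : S) : Prop :=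
  ∃ (π : Packet k n) (h : History k n), r ≤ p.denote (π, []) h

end Semantics

/-! ### Gödel numbering of policies -/

/-- Gödel number of a predicate. -/
def Predicate.code {k n : ℕ} : Predicate k n → ℕ
  | .false => Nat.pair 1 0
  | .true => Nat.pair 2 0
  | .test f v => Nat.pair 3 (Nat.pair f v)
  | .or t u => Nat.pair 4 (Nat.pair t.code u.code)
  | .and t u => Nat.pair 5 (Nat.pair t.code u.code)
  | .not t => Nat.pair 6 t.code

/-- Gödel number of a policy, where weights are represented by their numbers under `enc`. -/
def Policy.code {S : Type*} (enc : S → ℕ) {k n : ℕ} : Policy S k n → ℕ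
  | .filter t => Nat.pair 1 t.code
  | .modify f v => Nat.pair 2 (Nat.pair f v)
  | .dup => Nat.pair 3 0
  | .seq p q => Nat.pair 4 (Nat.pair (p.code enc) (q.code enc))
  | .weight r p => Nat.pair 5 (Nat.pair (enc r) (p.code enc))
  | .choice p q => Nat.pair 6 (Nat.pair (p.code enc) (q.code enc))
  | .iter p => Nat.pair 7 (p.code enc)

end WNetKAT

namespace WNetKAT

open OmegaCompletePartialOrder

/-! ### Sums as suprema in an ordered semiring with selective addition -/

section CountableSums

variable {S : Type*} [OmegaContinuousSemiring S]

/-! Taking `s₃ = s₁ + s₂` in `hadd` shows that a sum lies below one of its summands. So the order is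
total, addition is maximum and countable sums are suprema. By `hmul`, `1` is the greatest element,
so a product lies below each factor. Reachability thus becomes a best-path problem in which detours
never pay.

A policy reads only the head packet and only pushes packets onto the tail. A finite table indexed by
first and last head packet therefore suffices, each entry holding a best weight and the packets
recorded on a route that attains it. For iteration the table is closed by Floyd–Warshall. Loops
cannot improve a weight, so no star of a diagonal entry is needed, and the supremum over all
iterates is attained at one of them. `Policy.denote_le_routes` gives the upper bound and
`Policy.realizes_routes` the attainment.

For computability, `courseRec_policyStep` evaluates Gödel numbers by course-of-values recursion,
using routes whose weights are numbers. Table operations commute with homomorphisms of routes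
(`RouteOps.IsHom`), so this yields the image of the true table. Searching its finitely many entries
decides reachability and supplies the witness. -/

theorem mul_le_mul_both {a b c d : S} (hab : a ≤ b) (hcd : c ≤ d) : a * c ≤ b * d :=
  ((OmegaContinuousSemiring.mul_right_continuous c).monotone hab).trans
    ((OmegaContinuousSemiring.mul_left_continuous b).monotone hcd)

theorem le_add_self_left (a b : S) : b ≤ a + b := by
  rw [add_comm]; exact le_add_self_right b a

theorem le_csum {I : Type*} [Countable I] (f : I → S) (i : I) : f i ≤ csum f := by
  let _ := Encodable.ofCountable I
  refine le_trans ?_ (le_ωSup (partialSums f) (Encodable.encode i + 1))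
  change f i ≤ ∑ j ∈ Finset.range (Encodable.encode i + 1), (Encodable.decode₂ I j).elim 0 f
  rw [Finset.sum_range_succ, Encodable.encodek₂]
  exact le_add_self_left _ _

theorem sum_le_of_forall_le {J : Type*} (hadd : ∀ s₁ s₂ s₃ : S, s₃ ≤ s₁ + s₂ ↔ s₃ ≤ s₁ ∨ s₃ ≤ s₂)
    {s : Finset J} {g : J → S} {b : S} (h : ∀ j ∈ s, g j ≤ b) : ∑ j ∈ s, g j ≤ b := by
  classical
  induction s using Finset.induction_on with
  | empty => simpa using OmegaContinuousSemiring.zero_least b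
  | insert j s hj ih =>
    rw [Finset.sum_insert hj]
    rcases (hadd _ _ _).1 (le_refl (g j + ∑ x ∈ s, g x)) with h' | h'
    · exact h'.trans (h j (Finset.mem_insert_self _ _))
    · exact h'.trans (ih fun x hx => h x (Finset.mem_insert_of_mem hx))

/-- Continuity moves the factor inside the supremum and distributivity moves it inside each partial
sum, where selectivity of addition applies. The factor is needed to compose iterates; `csum_le` is
the case `c = 1`. -/
theorem csum_mul_le {I : Type*} [Countable I]
    (hadd : ∀ s₁ s₂ s₃ : S, s₃ ≤ s₁ + s₂ ↔ s₃ ≤ s₁ ∨ s₃ ≤ s₂)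
    {f : I → S} {c b : S} (h : ∀ i, f i * c ≤ b) : csum f * c ≤ b := by
  have hc := OmegaContinuousSemiring.mul_right_continuous c
  refine (hc.isLUB (c := partialSums f)).2 ?_
  rintro _ ⟨n, rfl⟩
  change (∑ j ∈ Finset.range n, (@Encodable.decode₂ I (Encodable.ofCountable I) j).elim 0 f) * c ≤ b
  rw [Finset.sum_mul]
  refine sum_le_of_forall_le hadd fun j _ => ?_
  cases @Encodable.decode₂ I (Encodable.ofCountable I) j with
  | none => simpa using OmegaContinuousSemiring.zero_least b
  | some i => exact h i

theorem csum_le {I : Type*} [Countable I]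
    (hadd : ∀ s₁ s₂ s₃ : S, s₃ ≤ s₁ + s₂ ↔ s₃ ≤ s₁ ∨ s₃ ≤ s₂)
    {f : I → S} {b : S} (h : ∀ i, f i ≤ b) : csum f ≤ b := by
  simpa using csum_mul_le hadd (c := 1) (b := b) (f := f) (by simpa using h)

theorem add_le_of_le (hadd : ∀ s₁ s₂ s₃ : S, s₃ ≤ s₁ + s₂ ↔ s₃ ≤ s₁ ∨ s₃ ≤ s₂)
    {a b c : S} (ha : a ≤ c) (hb : b ≤ c) : a + b ≤ c :=
  ((hadd a b (a + b)).1 le_rfl).elim (·.trans ha) (·.trans hb)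

theorem mul_le_left_of_mul_le_right (hmul : ∀ s₁ s₂ : S, s₁ * s₂ ≤ s₁) (a b : S) : a * b ≤ b := by
  have h : a ≤ 1 := by simpa using hmul 1 a
  simpa using mul_le_mul_both h (le_refl b)

theorem bind_le {X : Type*} [Countable X]
    (hadd : ∀ s₁ s₂ s₃ : S, s₃ ≤ s₁ + s₂ ↔ s₃ ≤ s₁ ∨ s₃ ≤ s₂)
    {m : Weighting S X} {f : X → Weighting S X} {y : X} {b : S} (h : ∀ x, m x * f x y ≤ b) :
    m.bind f y ≤ b :=
  csum_le hadd fun x => h x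

theorem le_bind {X : Type*} [Countable X] (m : Weighting S X) (f : X → Weighting S X) (x y : X) :
    m x * f x y ≤ m.bind f y := by
  by_cases hx : m x = 0
  · simpa [hx] using OmegaContinuousSemiring.zero_least (m.bind f y)
  · exact le_csum (fun x : Function.support m => m x * f x y) ⟨x, hx⟩

/-- This half of `fᵃ ; fᵇ = fᵃ⁺ᵇ` is what concatenating two routes requires. Iterates unfold on the
left, hence induction on `a` with the start varying. -/
theorem iterate_mul_iterate_le {X : Type*} [Countable X] [DecidableEq X]
    (hadd : ∀ s₁ s₂ s₃ : S, s₃ ≤ s₁ + s₂ ↔ s₃ ≤ s₁ ∨ s₃ ≤ s₂)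
    (f : X → Weighting S X) (a b : ℕ) (x y z : X) :
    Weighting.iterate f a x y * Weighting.iterate f b y z ≤ Weighting.iterate f (a + b) x z := by
  induction a generalizing x with
  | zero =>
    by_cases hxy : x = y
    · simp [Weighting.iterate, Weighting.unit, hxy]
    · simpa [Weighting.iterate, Weighting.unit, hxy] using OmegaContinuousSemiring.zero_least _
  | succ a ih =>
    rw [Nat.succ_add]
    refine csum_mul_le hadd fun w => ?_
    rw [mul_assoc]
    exact (mul_le_mul_both le_rfl (ih w)).trans (le_bind (f x) (Weighting.iterate f (a + b)) w z)

end CountableSums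

/-! ### Tables of optimal routes -/

/-- Operations on candidate routes: the absent route, the empty route, the recording of a packet,
a bare weight, the choice of the better of two routes, and concatenation. -/
structure RouteOps (P W X : Type*) where
  zero : X
  one : X
  mark : P → X
  weight : W → X
  add : X → X → X
  mul : X → X → X

namespace RouteOps

variable {P W X Y : Type*}

/-- Matrix product, with intermediate points taken from a list. -/
def compose (o : RouteOps P W X) (l : List P) (A B : P × P → X) (e : P × P) : X :=
  l.foldr (fun x acc => o.add (o.mul (A (e.1, x)) (B (x, e.2))) acc) o.zero

/-- Allow one more intermediate point. -/
def relax (o : RouteOps P W X) (A : P × P → X) (x : P) (e : P × P) : X :=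
  o.add (A e) (o.mul (A (e.1, x)) (A (x, e.2)))

/-- The diagonal table. -/
def diag [DecidableEq P] (o : RouteOps P W X) (e : P × P) : X :=
  if e.1 = e.2 then o.one else o.zero

/-- Entrywise choice. -/
def sup (o : RouteOps P W X) (A B : P × P → X) (e : P × P) : X := o.add (A e) (B e)

/-- Reflexive-transitive closure, by the Floyd–Warshall algorithm. -/
def star [DecidableEq P] (o : RouteOps P W X) (l : List P) (A : P × P → X) : P × P → X :=
  l.foldl o.relax (o.sup o.diag A)

/-- A map compatible with two families of operations. -/
structure IsHom {V : Type*} (o : RouteOps P W X) (o' : RouteOps P V Y) (e : W → V) (φ : X → Y) :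
    Prop where
  zero : φ o.zero = o'.zero
  one : φ o.one = o'.one
  mark : ∀ x, φ (o.mark x) = o'.mark x
  weight : ∀ r, φ (o.weight r) = o'.weight (e r)
  add : ∀ a b, φ (o.add a b) = o'.add (φ a) (φ b)
  mul : ∀ a b, φ (o.mul a b) = o'.mul (φ a) (φ b)

section Hom

variable {V : Type*} {o : RouteOps P W X} {o' : RouteOps P V Y} {e : W → V} {φ : X → Y}

theorem IsHom.compose (h : IsHom o o' e φ) (l : List P) (A B : P × P → X) :
    φ ∘ o.compose l A B = o'.compose l (φ ∘ A) (φ ∘ B) := by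
  funext x
  simp only [Function.comp, RouteOps.compose]
  induction l with
  | nil => exact h.zero
  | cons a l ih => simp [h.add, h.mul, ih]

theorem IsHom.relax (h : IsHom o o' e φ) (A : P × P → X) (x : P) :
    φ ∘ o.relax A x = o'.relax (φ ∘ A) x := by
  funext y
  simp [RouteOps.relax, h.add, h.mul]

theorem IsHom.diag [DecidableEq P] (h : IsHom o o' e φ) : φ ∘ o.diag = o'.diag := by
  funext y
  simp only [Function.comp, RouteOps.diag]
  split_ifs <;> simp [h.one, h.zero]

theorem IsHom.sup (h : IsHom o o' e φ) (A B : P × P → X) :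
    φ ∘ o.sup A B = o'.sup (φ ∘ A) (φ ∘ B) := by
  funext y
  simp [RouteOps.sup, h.add]

theorem IsHom.star [DecidableEq P] (h : IsHom o o' e φ) (l : List P) (A : P × P → X) :
    φ ∘ o.star l A = o'.star l (φ ∘ A) := by
  have key : ∀ (l : List P) (A : P × P → X),
      φ ∘ l.foldl o.relax A = l.foldl o'.relax (φ ∘ A) := by
    intro l
    induction l with
    | nil => intro A; rfl
    | cons x l ih => intro A; simp [ih, h.relax]
  rw [RouteOps.star, RouteOps.star, key, h.sup, h.diag]

end Hom

end RouteOps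

/-- The table of a predicate filter. -/
def RouteOps.filter {P W X : Type*} [DecidableEq P] (o : RouteOps P W X) (t : P → Bool)
    (e : P × P) : X :=
  if t e.1 = true then o.diag e else o.zero

/-- The table of a deterministic modification. -/
def RouteOps.move {P W X : Type*} [DecidableEq P] (o : RouteOps P W X) (m : P → P)
    (e : P × P) : X :=
  if m e.1 = e.2 then o.one else o.zero

/-- The table of `dup`. -/
def RouteOps.record {P W X : Type*} [DecidableEq P] (o : RouteOps P W X) (e : P × P) : X :=
  if e.1 = e.2 then o.mark e.1 else o.zero

/-- Multiplication of a table by a weight. -/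
def RouteOps.scale {P W X : Type*} (o : RouteOps P W X) (r : W) (A : P × P → X) (e : P × P) : X :=
  o.mul (o.weight r) (A e)

/-- The table of optimal routes of a policy, indexed by the first and last head packet. -/
noncomputable def Policy.routes {S X : Type*} {k n : ℕ} (o : RouteOps (Packet k n) S X) :
    Policy S k n → Packet k n × Packet k n → X
  | .filter t => o.filter t.eval
  | .modify f v => o.move fun π => Function.update π f v
  | .dup => o.record
  | .seq p q => o.compose Finset.univ.toList (p.routes o) (q.routes o)
  | .weight r p => o.scale r (p.routes o)
  | .choice p q => o.sup (p.routes o) (q.routes o)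
  | .iter p => o.star Finset.univ.toList (p.routes o)

/-- Routes as pairs of a weight in `S` and the list of packets that are recorded. -/
noncomputable def weightedRoutes (S P : Type*) [OmegaContinuousSemiring S] :
    RouteOps P S (S × List P) where
  zero := (0, [])
  one := (1, [])
  mark π := (1, [π])
  weight r := (r, [])
  add a b := open Classical in if a.1 ≤ b.1 then b else a
  mul a b := (a.1 * b.1, b.2 ++ a.2)

/-! ### Optimality and invariants of route tables -/

section Optimality

variable {S : Type*} [OmegaContinuousSemiring S] {P : Type*}

local notation "ops" => weightedRoutes S P

/-- Choice keeps a weight together with its own recorded list, so an invariant shared by both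
candidates survives. -/
theorem weightedRoutes_add_eq (a b : S × List P) : (ops).add a b = a ∨ (ops).add a b = b := by
  simp only [weightedRoutes]
  split_ifs <;> simp

theorem le_weightedRoutes_add_right (a b : S × List P)
    (hadd : ∀ s₁ s₂ s₃ : S, s₃ ≤ s₁ + s₂ ↔ s₃ ≤ s₁ ∨ s₃ ≤ s₂) :
    b.1 ≤ ((ops).add a b).1 := by
  simp only [weightedRoutes]
  split_ifs with h
  · exact le_rfl
  -- Totality of the order: the sum lies below one summand, hence so does the other summand.
  · rcases (hadd a.1 b.1 (a.1 + b.1)).1 le_rfl with h' | h'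
    · exact (le_add_self_left _ _).trans h'
    · exact absurd ((le_add_self_right _ _).trans h') h

theorem le_weightedRoutes_add_left (a b : S × List P) : a.1 ≤ ((ops).add a b).1 := by
  simp only [weightedRoutes]
  split_ifs with h
  · exact h
  · exact le_rfl

theorem le_compose (hadd : ∀ s₁ s₂ s₃ : S, s₃ ≤ s₁ + s₂ ↔ s₃ ≤ s₁ ∨ s₃ ≤ s₂)
    (l : List P) (A B : P × P → S × List P) (i j x : P) (hx : x ∈ l) :
    (A (i, x)).1 * (B (x, j)).1 ≤ ((ops).compose l A B (i, j)).1 := by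
  induction l with
  | nil => simp at hx
  | cons y l ih =>
    rcases List.mem_cons.1 hx with rfl | hx
    · exact le_weightedRoutes_add_left ((ops).mul (A (i, x)) (B (x, j))) _
    · exact (ih hx).trans (le_weightedRoutes_add_right _ _ hadd)

theorem compose_induction (l : List P) (A B : P × P → S × List P) (i j : P)
    {Q : S × List P → Prop} (h0 : Q (ops).zero)
    (h : ∀ x, Q ((ops).mul (A (i, x)) (B (x, j)))) : Q ((ops).compose l A B (i, j)) := by
  induction l with
  | nil => exact h0
  | cons y l ih =>
    change Q ((ops).add ((ops).mul (A (i, y)) (B (y, j))) ((ops).compose l A B (i, j)))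
    rcases weightedRoutes_add_eq ((ops).mul (A (i, y)) (B (y, j)))
      ((ops).compose l A B (i, j)) with h' | h' <;> rw [h']
    exacts [h y, ih]

theorem le_foldl_relax (l : List P) (A : P × P → S × List P) (e : P × P) :
    (A e).1 ≤ (l.foldl (ops).relax A e).1 := by
  induction l generalizing A with
  | nil => exact le_rfl
  | cons x l ih => exact (le_weightedRoutes_add_left (A e) _).trans (ih ((ops).relax A x))

/-- The Floyd–Warshall invariant: `s` collects the points already processed, through which the
triangle inequality holds. Relaxing at `y` adds `y` to `s` and preserves the inequality at the old
points. -/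
theorem foldl_relax_transitive (hmul : ∀ s₁ s₂ : S, s₁ * s₂ ≤ s₁)
    (hadd : ∀ s₁ s₂ s₃ : S, s₃ ≤ s₁ + s₂ ↔ s₃ ≤ s₁ ∨ s₃ ≤ s₂)
    (l : List P) (s : Set P) (A : P × P → S × List P)
    (hA : ∀ x ∈ s, ∀ i j, (A (i, x)).1 * (A (x, j)).1 ≤ (A (i, j)).1)
    (x : P) (hx : x ∈ s ∨ x ∈ l) (i j : P) :
    (l.foldl (ops).relax A (i, x)).1 * (l.foldl (ops).relax A (x, j)).1 ≤
      (l.foldl (ops).relax A (i, j)).1 := by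
  have hmul' := mul_le_left_of_mul_le_right hmul
  induction l generalizing s A with
  | nil => exact hA x (by simpa using hx) i j
  | cons y l ih =>
    refine ih (insert y s) ((ops).relax A y) ?_ (by
      rcases hx with hx | hx
      · exact Or.inl (Or.inr hx)
      · rcases List.mem_cons.1 hx with rfl | hx
        · exact Or.inl (Or.inl rfl)
        · exact Or.inr hx)
    clear hx
    have old : ∀ e, (A e).1 ≤ ((ops).relax A y e).1 := fun e => le_weightedRoutes_add_left _ _
    have new : ∀ a b, (A (a, y)).1 * (A (y, b)).1 ≤ ((ops).relax A y (a, b)).1 := fun a b =>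
      le_weightedRoutes_add_right (A (a, b)) ((ops).mul (A (a, y)) (A (y, b))) hadd
    have cases_ : ∀ a b, ((ops).relax A y (a, b)).1 ≤ (A (a, b)).1 ∨
        ((ops).relax A y (a, b)).1 ≤ (A (a, y)).1 * (A (y, b)).1 := fun a b => by
      rcases weightedRoutes_add_eq (A (a, b)) ((ops).mul (A (a, y)) (A (y, b))) with h | h
      · exact Or.inl (congrArg Prod.fst h).le
      · exact Or.inr (congrArg Prod.fst h).le
    rintro z (rfl | hz) a b
    -- At the new point itself, relaxing only appends a loop at `z`, which cannot raise the weight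
    -- of an entry starting or ending there.
    · have h1 : ((ops).relax A z (a, z)).1 ≤ (A (a, z)).1 :=
        (cases_ a z).elim _root_.id (·.trans (hmul _ _))
      have h2 : ((ops).relax A z (z, b)).1 ≤ (A (z, b)).1 :=
        (cases_ z b).elim _root_.id (·.trans (hmul' _ _))
      exact (mul_le_mul_both h1 h2).trans (new a b)
    · rcases cases_ a z with h1 | h1 <;> rcases cases_ z b with h2 | h2 <;>
        refine (mul_le_mul_both h1 h2).trans ?_
      · exact (hA z hz a b).trans (old _)
      · rw [← mul_assoc]
        exact (mul_le_mul_both (hA z hz a y) le_rfl).trans (new a b)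
      · rw [mul_assoc]
        exact (mul_le_mul_both le_rfl (hA z hz y b)).trans (new a b)
      -- Both halves pass through `y`; the loop from `y` via `z` back to `y` is dropped.
      · refine (mul_le_mul_both (hmul _ _) (hmul' _ _)).trans (new a b)

/-- Relaxation creates entries only by concatenation and choice, so a relation between endpoints and
routes that is closed under concatenation persists. -/
theorem foldl_relax_induction {Q : P → P → S × List P → Prop}
    (hQ : ∀ i x j a b, Q i x a → Q x j b → Q i j ((ops).mul a b))
    (l : List P) (A : P × P → S × List P) (hA : ∀ i j, Q i j (A (i, j))) (i j : P) :
    Q i j (l.foldl (ops).relax A (i, j)) := by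
  induction l generalizing A with
  | nil => exact hA i j
  | cons x l ih =>
    refine ih ((ops).relax A x) fun a b => ?_
    rcases weightedRoutes_add_eq (A (a, b)) ((ops).mul (A (a, x)) (A (x, b))) with h | h
    · exact (congrArg (Q a b) h).mpr (hA a b)
    · exact (congrArg (Q a b) h).mpr (hQ _ _ _ _ _ (hA a x) (hA x b))

end Optimality

/-! ### The table bounds the semantics and is attained -/

section Correctness

variable {S : Type*} [OmegaContinuousSemiring S] {k n : ℕ}

theorem zero_le_weight (s : S) : 0 ≤ s := OmegaContinuousSemiring.zero_least s

/-- Every weight of a policy is bounded by the corresponding entry of its table. -/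
theorem Policy.denote_le_routes (hmul : ∀ s₁ s₂ : S, s₁ * s₂ ≤ s₁)
    (hadd : ∀ s₁ s₂ s₃ : S, s₃ ≤ s₁ + s₂ ↔ s₃ ≤ s₁ ∨ s₃ ≤ s₂)
    (p : Policy S k n) (h h' : History k n) :
    p.denote h h' ≤ (p.routes (weightedRoutes S (Packet k n)) (h.1, h'.1)).1 := by
  induction p generalizing h h' with
  | filter t =>
    by_cases ht : t.eval h.1 = true
    · by_cases hh : h = h'
      · subst hh
        simp [Policy.denote, Policy.routes, RouteOps.filter, RouteOps.diag, Weighting.unit, ht,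
          weightedRoutes]
      · simpa [Policy.denote, ht, Weighting.unit, hh] using zero_le_weight _
    · simpa [Policy.denote, ht] using zero_le_weight _
  | modify f v =>
    by_cases hh : (Function.update h.1 f v, h.2) = h'
    · subst hh
      simp [Policy.denote, Policy.routes, RouteOps.move, Weighting.unit, weightedRoutes]
    · simpa [Policy.denote, Weighting.unit, hh] using zero_le_weight _
  | dup =>
    by_cases hh : (h.1, h.1 :: h.2) = h'
    · subst hh
      simp [Policy.denote, Policy.routes, RouteOps.record, Weighting.unit, weightedRoutes]
    · simpa [Policy.denote, Weighting.unit, hh] using zero_le_weight _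
  | seq p q ihp ihq =>
    exact bind_le hadd fun x => (mul_le_mul_both (ihp h x) (ihq x h')).trans
      (le_compose hadd _ _ _ _ _ _ (Finset.mem_toList.2 (Finset.mem_univ _)))
  | weight r p ih => exact mul_le_mul_both le_rfl (ih h h')
  | choice p q ihp ihq =>
    exact add_le_of_le hadd ((ihp h h').trans (le_weightedRoutes_add_left _ _))
      ((ihq h h').trans (le_weightedRoutes_add_right _ _ hadd))
  | iter p ih =>
    refine csum_le hadd fun m => ?_
    induction m generalizing h with
    | zero =>
      by_cases hh : h = h'
      · subst hh
        refine le_trans ?_ (le_foldl_relax _ _ _)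
        refine le_trans ?_ (le_weightedRoutes_add_left _ _)
        simp [Weighting.iterate, Weighting.unit, RouteOps.diag, weightedRoutes]
      · simpa [Weighting.iterate, Weighting.unit, hh] using zero_le_weight _
    | succ m ihm =>
      -- The first step is bounded by the table of `p`, the rest by the closed table. Transitivity
      -- at the intermediate head packet joins them; no point is processed at the outset, and the
      -- list contains every packet.
      refine bind_le hadd fun x => (mul_le_mul_both ?_ (ihm x)).trans
        (foldl_relax_transitive hmul hadd _ ∅ _ (by simp) x.1
          (Or.inr (Finset.mem_toList.2 (Finset.mem_univ _))) _ _)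
      exact (ih h x).trans ((le_weightedRoutes_add_right
        ((weightedRoutes S (Packet k n)).diag (h.1, x.1)) _ hadd).trans
        (le_foldl_relax _ ((weightedRoutes S (Packet k n)).sup _ _) _))

/-- A route is realized if its weight is reached by recording its packets. -/
def Realizes (d : History k n → Weighting S (History k n)) (i j : Packet k n)
    (e : S × List (Packet k n)) : Prop :=
  ∀ t, e.1 ≤ d (i, t) (j, e.2 ++ t)

theorem realizes_zero (d : History k n → Weighting S (History k n)) (i j : Packet k n) :
    Realizes d i j (weightedRoutes S (Packet k n)).zero :=
  fun _ => zero_le_weight _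

/-- Every entry of the table of a policy is attained. -/
theorem Policy.realizes_routes
    (hadd : ∀ s₁ s₂ s₃ : S, s₃ ≤ s₁ + s₂ ↔ s₃ ≤ s₁ ∨ s₃ ≤ s₂)
    (p : Policy S k n) (i j : Packet k n) :
    Realizes p.denote i j (p.routes (weightedRoutes S (Packet k n)) (i, j)) := by
  induction p generalizing i j with
  | filter t =>
    by_cases ht : t.eval i = true
    · by_cases hh : i = j
      · intro u
        simp [Policy.denote, Policy.routes, RouteOps.filter, RouteOps.diag, Weighting.unit, hh ▸ ht,
          hh, weightedRoutes]
      · simpa [Policy.routes, RouteOps.filter, RouteOps.diag, hh, ht] using realizes_zero _ i j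
    · simpa [Policy.routes, RouteOps.filter, ht] using realizes_zero _ i j
  | modify f v =>
    by_cases hh : Function.update i f v = j
    · intro u
      simp [Policy.denote, Policy.routes, RouteOps.move, Weighting.unit, hh, weightedRoutes]
    · simpa [Policy.routes, RouteOps.move, hh] using realizes_zero _ i j
  | dup =>
    by_cases hh : i = j
    · intro u
      simp [Policy.denote, Policy.routes, RouteOps.record, Weighting.unit, hh, weightedRoutes]
    · simpa [Policy.routes, RouteOps.record, hh] using realizes_zero _ i j
  | seq p q ihp ihq =>
    refine compose_induction _ _ _ i j (realizes_zero _ i j) fun x u => ?_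
    refine le_trans (mul_le_mul_both (ihp i x u) (ihq x j
      ((p.routes (weightedRoutes S (Packet k n)) (i, x)).2 ++ u))) ?_
    refine (le_bind (p.denote (i, u)) q.denote _ _).trans (le_of_eq ?_)
    -- Histories list the newest packet first, so the packets recorded by `q` precede those recorded
    -- by `p`.
    simp [Policy.denote, weightedRoutes]
  | weight r p ih =>
    intro u
    simpa [Policy.denote, Policy.routes, RouteOps.scale, weightedRoutes] using
      mul_le_mul_both (le_refl r) (ih i j u)
  | choice p q ihp ihq =>
    intro u
    rcases weightedRoutes_add_eq (p.routes (weightedRoutes S (Packet k n)) (i, j))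
      (q.routes (weightedRoutes S (Packet k n)) (i, j)) with h | h <;>
      simp only [Policy.routes, RouteOps.sup, h, Policy.denote]
    · exact (ihp i j u).trans (le_add_self_right _ _)
    · exact (ihq i j u).trans (le_add_self_left _ _)
  | iter p ih =>
    -- A single iterate attains the entry, for all tails at once: exponents add under concatenation,
    -- diagonal entries use exponent `0` and entries of `p` exponent `1`.
    have key : ∃ m, Realizes (Weighting.iterate p.denote m) i j
        ((Policy.iter p).routes (weightedRoutes S (Packet k n)) (i, j)) := by
      refine foldl_relax_induction
        (Q := fun i j e => ∃ m, Realizes (Weighting.iterate p.denote m) i j e) ?_ _ _ ?_ i j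
      · rintro a x b e f ⟨m, hm⟩ ⟨m', hm'⟩
        refine ⟨m + m', fun u => ?_⟩
        refine (mul_le_mul_both (hm u) (hm' (e.2 ++ u))).trans
          ((iterate_mul_iterate_le hadd p.denote m m' _ _ _).trans (le_of_eq ?_))
        simp [weightedRoutes]
      · intro a b
        rcases weightedRoutes_add_eq ((weightedRoutes S (Packet k n)).diag (a, b))
          (p.routes (weightedRoutes S (Packet k n)) (a, b)) with h | h <;>
          rw [RouteOps.sup, h]
        · refine ⟨0, ?_⟩
          by_cases hab : a = b
          · intro u
            simp [RouteOps.diag, hab, weightedRoutes, Weighting.iterate, Weighting.unit]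
          · simpa [RouteOps.diag, hab] using realizes_zero _ a b
        · refine ⟨1, fun u => (ih a b u).trans ?_⟩
          refine le_trans (le_of_eq ?_) (le_bind (p.denote (a, u)) (Weighting.iterate p.denote 0)
            (b, (p.routes (weightedRoutes S (Packet k n)) (a, b)).2 ++ u) _)
          simp [Weighting.iterate, Weighting.unit]
    obtain ⟨m, hm⟩ := key
    exact fun u => (hm u).trans (le_csum (fun m => Weighting.iterate p.denote m _ _) m)

end Correctness

end WNetKAT

namespace WNetKAT

open Encodable

/-! ### Computability of finite tables -/

/-- Functions on a finite index type, as a type of numbered data. -/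
def Table (ι α : Type*) : Type _ := ι → α

namespace Table

variable {ι α β : Type*} [Fintype ι] [Primcodable α] [Primcodable β]

/-- A table as the vector of its values. -/
noncomputable def equivVector (ι α : Type*) [Fintype ι] :
    Table ι α ≃ List.Vector α (Fintype.card ι) :=
  (Equiv.arrowCongr (Fintype.equivFin ι) (Equiv.refl α)).trans (Equiv.vectorEquivFin _ _).symm

omit [Primcodable α] in
theorem get_equivVector (T : Table ι α) (i : Fin (Fintype.card ι)) :
    (equivVector ι α T).get i = T ((Fintype.equivFin ι).symm i) :=
  List.Vector.get_ofFn _ _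

noncomputable instance : Primcodable (Table ι α) :=
  Primcodable.ofEquiv _ (equivVector ι α)

/-- A table is a vector of fixed length, so finitely many programs, one per index, are joined into
one. Nothing uniform in the index is required. -/
theorem computable_of_forall {f : β → Table ι α} (h : ∀ i, Computable fun b => f b i) :
    Computable f := by
  have h1 : Computable fun b => List.Vector.ofFn fun i => f b ((Fintype.equivFin ι).symm i) :=
    Computable.vector_ofFn fun i => h _
  refine ((Primrec.of_equiv_symm (e := equivVector ι α)).to_comp.comp h1).of_eq fun b => ?_
  rw [Equiv.symm_apply_eq]
  apply List.Vector.ext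
  intro i
  rw [List.Vector.get_ofFn, get_equivVector]

theorem computable_apply {f : β → Table ι α} (h : Computable f) (i : ι) :
    Computable fun b => f b i := by
  have h1 : Computable fun b => equivVector ι α (f b) :=
    (Primrec.of_equiv (e := equivVector ι α)).to_comp.comp h
  refine (Computable.vector_get.comp h1
    (Computable.const (Fintype.equivFin ι i))).of_eq fun b => ?_
  rw [get_equivVector, Equiv.symm_apply_apply]

end Table

/-! ### Course-of-values recursion -/

section CourseOfValues

variable {M : Type*}

/-- The list of the first values of a function defined by course-of-values recursion. -/
def courseValues (g : List M → M) : ℕ → List M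
  | 0 => []
  | n + 1 => courseValues g n ++ [g (courseValues g n)]

/-- The function defined by course-of-values recursion. -/
def courseRec (g : List M → M) (n : ℕ) : M := g (courseValues g n)

theorem length_courseValues (g : List M → M) (n : ℕ) : (courseValues g n).length = n := by
  induction n with
  | zero => rfl
  | succ n ih => simp [courseValues, ih]

theorem getElem?_courseValues (g : List M → M) {m n : ℕ} (h : m < n) :
    (courseValues g n)[m]? = some (courseRec g m) := by
  induction n with
  | zero => omega
  | succ n ih =>
    rcases Nat.lt_succ_iff_lt_or_eq.1 h with h' | rfl
    · rw [courseValues, List.getElem?_append_left (by rwa [length_courseValues]), ih h']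
    · rw [courseValues, List.getElem?_append_right (by rw [length_courseValues]),
        length_courseValues]
      simp [courseRec]

theorem computable_courseRec [Primcodable M] {g : List M → M} (hg : Computable g) :
    Computable (courseRec g) := by
  refine hg.comp ?_
  have h : Computable₂ fun (_ : ℕ) (q : ℕ × List M) => q.2 ++ [g q.2] :=
    Computable.list_concat.comp (Computable.snd.comp Computable.snd)
      (hg.comp (Computable.snd.comp Computable.snd))
  refine (Computable.nat_rec Computable.id (Computable.const []) h).of_eq fun n => ?_
  induction n with
  | zero => rfl
  | succ n ih => simp_all [courseValues]

end CourseOfValues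

/-- This is why tags start at `1`: codes of subterms are then strictly smaller, so their values are
already in the list. With tag `0` it fails, as `Nat.pair 0 0 = 0`. -/
theorem lt_pair_of_pos {t : ℕ} (ht : 1 ≤ t) (x : ℕ) : x < Nat.pair t x := by
  unfold Nat.pair
  split_ifs with h
  · nlinarith
  · nlinarith

theorem lt_pair_pair_left {t : ℕ} (ht : 1 ≤ t) (a b : ℕ) : a < Nat.pair t (Nat.pair a b) :=
  (Nat.left_le_pair a b).trans_lt (lt_pair_of_pos ht _)

theorem lt_pair_pair_right {t : ℕ} (ht : 1 ≤ t) (a b : ℕ) : b < Nat.pair t (Nat.pair a b) :=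
  (Nat.right_le_pair a b).trans_lt (lt_pair_of_pos ht _)

/-- Computable case distinction on the tag of a Gödel number. -/
theorem computable_tag_cond {β M : Type*} [Primcodable β] [Primcodable M] {t : β → ℕ}
    (ht : Computable t) (c : ℕ) {f g : β → M} (hf : Computable f) (hg : Computable g) :
    Computable fun b => bif t b == c then f b else g b :=
  Computable.cond (Primrec.beq.to_comp.comp ht (Computable.const c)) hf hg

section Lookup

variable {M : Type*} [Primcodable M]

theorem computable_lookup {i : List M → ℕ} (hi : Computable i) (d : M) :
    Computable fun l : List M => l[i l]?.getD d :=
  Computable.option_getD (Computable.list_getElem?.comp Computable.id hi) (Computable.const d)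

/-- The list of earlier values is as long as the current argument, so the number being evaluated is
read off from its length. -/
theorem computable_tag : Computable fun l : List M => l.length.unpair.1 :=
  Computable.fst.comp (Computable.unpair.comp Computable.list_length)

theorem computable_arg : Computable fun l : List M => l.length.unpair.2 :=
  Computable.snd.comp (Computable.unpair.comp Computable.list_length)

theorem computable_arg_left : Computable fun l : List M => l.length.unpair.2.unpair.1 :=
  Computable.fst.comp (Computable.unpair.comp computable_arg)

theorem computable_arg_right : Computable fun l : List M => l.length.unpair.2.unpair.2 :=
  Computable.snd.comp (Computable.unpair.comp computable_arg)

end Lookup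

/-! ### Evaluation of Gödel numbers of predicates -/

section PredicateCodes

variable {k n : ℕ}

/-- The truth table of an atomic test, given by the numbers of a field and a value. -/
def testTable (x : ℕ) : Table (Packet k n) Bool :=
  (decode (α := Fin k × Fin n) x).elim (fun _ => false) fun fv π => decide (π fv.1 = fv.2)

/-- One step of the evaluation of Gödel numbers of predicates. -/
def predicateStep (l : List (Table (Packet k n) Bool)) : Table (Packet k n) Bool := fun π =>
  let t := l.length.unpair.1
  let x := l.length.unpair.2
  let get := fun a => (l[a]?.getD fun _ => false : Table (Packet k n) Bool) π
  bif t == 1 then false else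
  bif t == 2 then true else
  bif t == 3 then testTable x π else
  bif t == 4 then get x.unpair.1 || get x.unpair.2 else
  bif t == 5 then get x.unpair.1 && get x.unpair.2 else
  !(get x)

theorem courseRec_predicateStep (t : Predicate k n) :
    courseRec predicateStep t.code = (t.eval : Table (Packet k n) Bool) := by
  funext π
  induction t with
  | false => simp [courseRec, predicateStep, length_courseValues, Predicate.code, Predicate.eval]
  | true => simp [courseRec, predicateStep, length_courseValues, Predicate.code, Predicate.eval]
  | test f v =>
    -- The Gödel number of a test pairs field and value exactly as the standard encoding of `Fin k ×
    -- Fin n` does.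
    have h : decode (α := Fin k × Fin n) (Nat.pair f v) = some (f, v) := encodek (f, v)
    simp [courseRec, predicateStep, length_courseValues, Predicate.code, Predicate.eval, testTable,
      h]
    rfl
  | or t u iht ihu =>
    rw [courseRec, Predicate.code]
    simp [predicateStep, length_courseValues, Predicate.eval, ← iht, ← ihu,
      getElem?_courseValues _ (lt_pair_pair_left (t := 4) (by norm_num) t.code u.code),
      getElem?_courseValues _ (lt_pair_pair_right (t := 4) (by norm_num) t.code u.code)]
    rfl
  | and t u iht ihu =>
    rw [courseRec, Predicate.code]
    simp [predicateStep, length_courseValues, Predicate.eval, ← iht, ← ihu,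
      getElem?_courseValues _ (lt_pair_pair_left (t := 5) (by norm_num) t.code u.code),
      getElem?_courseValues _ (lt_pair_pair_right (t := 5) (by norm_num) t.code u.code)]
    rfl
  | not t iht =>
    rw [courseRec, Predicate.code]
    simp [predicateStep, length_courseValues, Predicate.eval, ← iht,
      getElem?_courseValues _ (lt_pair_of_pos (t := 6) (by norm_num) t.code)]
    rfl

/-- After decoding, the argument ranges over a finite type, on which every function is primitive
recursive. -/
theorem computable_decode_elim {α M : Type*} [Primcodable α] [Finite α] [Primcodable M]
    (d : M) (f : α → M) : Computable fun x : ℕ => (decode (α := α) x).elim d f :=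
  (Primrec.dom_finite fun o : Option α => o.elim d f).to_comp.comp Primrec.decode.to_comp

theorem computable_predicateStep :
    Computable (predicateStep : List (Table (Packet k n) Bool) → _) := by
  refine Table.computable_of_forall fun π => ?_
  have get : ∀ {i : List (Table (Packet k n) Bool) → ℕ}, Computable i → Computable fun l =>
      (l[i l]?.getD fun _ => false : Table (Packet k n) Bool) π := fun hi =>
    Table.computable_apply (computable_lookup hi _) π
  refine computable_tag_cond computable_tag 1 (Computable.const _) ?_
  refine computable_tag_cond computable_tag 2 (Computable.const _) ?_
  refine computable_tag_cond computable_tag 3 ?_ ?_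
  · exact Table.computable_apply ((computable_decode_elim (M := Table (Packet k n) Bool) _ _).comp
      computable_arg) π
  refine computable_tag_cond computable_tag 4 ?_ ?_
  · exact Primrec.or.to_comp.comp (get computable_arg_left) (get computable_arg_right)
  refine computable_tag_cond computable_tag 5 ?_ ?_
  · exact Primrec.and.to_comp.comp (get computable_arg_left) (get computable_arg_right)
  · exact Primrec.not.to_comp.comp (get computable_arg)

end PredicateCodes

/-! ### Computability of operations on tables of routes -/

namespace RouteOps

section

variable {P X Y W V : Type*} {o : RouteOps P W X} {o' : RouteOps P V Y} {e : W → V} {φ : X → Y}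
  [DecidableEq P]

theorem IsHom.filter (h : IsHom o o' e φ) (t : P → Bool) : φ ∘ o.filter t = o'.filter t := by
  funext y
  simp only [Function.comp, RouteOps.filter]
  split_ifs
  · exact congrFun h.diag y
  · exact h.zero

theorem IsHom.move (h : IsHom o o' e φ) (m : P → P) : φ ∘ o.move m = o'.move m := by
  funext y
  simp only [Function.comp, RouteOps.move]
  split_ifs <;> simp [h.one, h.zero]

theorem IsHom.record (h : IsHom o o' e φ) : φ ∘ o.record = o'.record := by
  funext y
  simp only [Function.comp, RouteOps.record]
  split_ifs <;> simp [h.mark, h.zero]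

omit [DecidableEq P] in
theorem IsHom.scale (h : IsHom o o' e φ) (r : W) (A : P × P → X) :
    φ ∘ o.scale r A = o'.scale (e r) (φ ∘ A) := by
  funext y
  simp [RouteOps.scale, h.mul, h.weight]

end

variable {P X β : Type*} [Fintype P] [DecidableEq P] [Primcodable X] [Primcodable β]

/-- Computability of the operations on routes whose weights are numbers. -/
structure IsComputable (o : RouteOps P ℕ X) : Prop where
  weight : Computable o.weight
  add : Computable₂ o.add
  mul : Computable₂ o.mul

variable {o : RouteOps P ℕ X}

omit [DecidableEq P] in
theorem IsComputable.compose (h : o.IsComputable) (l : List P) {A B : β → Table (P × P) X}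
    (hA : Computable A) (hB : Computable B) :
    Computable (σ := Table (P × P) X) fun b => o.compose l (A b) (B b) := by
  refine Table.computable_of_forall fun e => ?_
  induction l with
  | nil => exact Computable.const _
  | cons x l ih =>
    exact h.add.comp (h.mul.comp (Table.computable_apply hA _) (Table.computable_apply hB _)) ih

omit [DecidableEq P] in
theorem IsComputable.sup (h : o.IsComputable) {A B : β → Table (P × P) X}
    (hA : Computable A) (hB : Computable B) :
    Computable (σ := Table (P × P) X) fun b => o.sup (A b) (B b) :=
  Table.computable_of_forall fun e =>
    h.add.comp (Table.computable_apply hA e) (Table.computable_apply hB e)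

omit [DecidableEq P] in
theorem IsComputable.scale (h : o.IsComputable) {r : β → ℕ} (hr : Computable r)
    {A : β → Table (P × P) X} (hA : Computable A) :
    Computable (σ := Table (P × P) X) fun b => o.scale (r b) (A b) :=
  Table.computable_of_forall fun e => h.mul.comp (h.weight.comp hr) (Table.computable_apply hA e)

omit [DecidableEq P] in
theorem IsComputable.relax (h : o.IsComputable) {A : β → Table (P × P) X} (hA : Computable A)
    (x : P) : Computable (σ := Table (P × P) X) fun b => o.relax (A b) x :=
  Table.computable_of_forall fun e => h.add.comp (Table.computable_apply hA e)
    (h.mul.comp (Table.computable_apply hA _) (Table.computable_apply hA _))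

theorem IsComputable.star (h : o.IsComputable) (l : List P) {A : β → Table (P × P) X}
    (hA : Computable A) : Computable (σ := Table (P × P) X) fun b => o.star l (A b) := by
  -- The list of points is fixed in advance, so the loop unrolls into a finite composition of
  -- programs.
  have key : ∀ (l : List P) {A : β → Table (P × P) X}, Computable A →
      Computable (σ := Table (P × P) X) fun b => l.foldl o.relax (A b) := by
    intro l
    induction l with
    | nil => exact fun hA => hA
    | cons x l ih => exact fun hA => ih (h.relax hA x)
  exact key l (h.sup (Computable.const _) hA)

theorem IsComputable.filter {t : β → Table P Bool} (ht : Computable t) :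
    Computable (σ := Table (P × P) X) fun b => o.filter (t b) := by
  refine Table.computable_of_forall fun e => ?_
  refine (Computable.cond (Table.computable_apply ht e.1) (Computable.const (o.diag e))
    (Computable.const o.zero)).of_eq fun b => ?_
  cases h : t b e.1 <;> simp [RouteOps.filter, h]

end RouteOps

/-! ### Evaluation of Gödel numbers of policies -/

section PolicyCodes

variable {k n : ℕ} {X : Type*}

/-- The table of a modification, given by the numbers of a field and a value. -/
def moveTable (o : RouteOps (Packet k n) ℕ X) (x : ℕ) : Table (Packet k n × Packet k n) X :=
  (decode (α := Fin k × Fin n) x).elim (fun _ => o.zero)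
    fun fv => o.move fun π => Function.update π fv.1 fv.2

/-- One step of the evaluation of Gödel numbers of policies. -/
noncomputable def policyStep (o : RouteOps (Packet k n) ℕ X)
    (l : List (Table (Packet k n × Packet k n) X)) : Table (Packet k n × Packet k n) X :=
  let t := l.length.unpair.1
  let x := l.length.unpair.2
  let get := fun a => (l[a]?.getD fun _ => o.zero : Table (Packet k n × Packet k n) X)
  bif t == 1 then o.filter (courseRec predicateStep x) else
  bif t == 2 then moveTable o x else
  bif t == 3 then o.record else
  bif t == 4 then o.compose Finset.univ.toList (get x.unpair.1) (get x.unpair.2) else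
  bif t == 5 then o.scale x.unpair.1 (get x.unpair.2) else
  bif t == 6 then o.sup (get x.unpair.1) (get x.unpair.2) else
  o.star Finset.univ.toList (get x)

/-- Each step uses only route operations, with which `φ` commutes; `o` itself need not be
computable. The lookup defaults never matter, since subterms have smaller codes. -/
theorem courseRec_policyStep {S Y : Type*} {enc : S → ℕ} {o : RouteOps (Packet k n) S Y}
    {o' : RouteOps (Packet k n) ℕ X} {φ : Y → X} (h : RouteOps.IsHom o o' enc φ)
    (p : Policy S k n) : courseRec (policyStep o') (p.code enc) = φ ∘ p.routes o := by
  induction p with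
  | filter t =>
    rw [courseRec, Policy.code]
    simp only [policyStep, length_courseValues, Policy.routes, h.filter, Nat.unpair_pair]
    exact congrArg o'.filter (courseRec_predicateStep t)
  | modify f v =>
    have hd : decode (α := Fin k × Fin n) (Nat.pair f v) = some (f, v) := encodek (f, v)
    simp [courseRec, policyStep, length_courseValues, Policy.code, Policy.routes, h.move, moveTable,
      hd]
    rfl
  | dup =>
    simp [courseRec, policyStep, length_courseValues, Policy.code, Policy.routes, h.record]
    rfl
  | seq p q ihp ihq =>
    rw [courseRec, Policy.code]
    simp [policyStep, length_courseValues, Policy.routes, h.compose, ← ihp, ← ihq,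
      getElem?_courseValues _ (lt_pair_pair_left (t := 4) (by norm_num) (p.code enc) (q.code enc)),
      getElem?_courseValues _ (lt_pair_pair_right (t := 4) (by norm_num) (p.code enc) (q.code enc))]
    rfl
  | weight r p ih =>
    rw [courseRec, Policy.code]
    simp [policyStep, length_courseValues, Policy.routes, h.scale, ← ih,
      getElem?_courseValues _ (lt_pair_pair_right (t := 5) (by norm_num) (enc r) (p.code enc))]
    rfl
  | choice p q ihp ihq =>
    rw [courseRec, Policy.code]
    simp [policyStep, length_courseValues, Policy.routes, h.sup, ← ihp, ← ihq,
      getElem?_courseValues _ (lt_pair_pair_left (t := 6) (by norm_num) (p.code enc) (q.code enc)),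
      getElem?_courseValues _ (lt_pair_pair_right (t := 6) (by norm_num) (p.code enc) (q.code enc))]
    rfl
  | iter p ih =>
    rw [courseRec, Policy.code]
    simp [policyStep, length_courseValues, Policy.routes, h.star, ← ih,
      getElem?_courseValues _ (lt_pair_of_pos (t := 7) (by norm_num) (p.code enc))]
    rfl

theorem computable_policyStep [Primcodable X] {o : RouteOps (Packet k n) ℕ X}
    (h : o.IsComputable) : Computable (policyStep o) := by
  have get : ∀ {i : List (Table (Packet k n × Packet k n) X) → ℕ}, Computable i →
      Computable fun l => (l[i l]?.getD fun _ => o.zero : Table (Packet k n × Packet k n) X) :=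
    fun hi => computable_lookup hi _
  refine computable_tag_cond computable_tag 1 ?_ ?_
  · exact RouteOps.IsComputable.filter
      ((computable_courseRec computable_predicateStep).comp computable_arg)
  refine computable_tag_cond computable_tag 2 ?_ ?_
  · exact (computable_decode_elim (M := Table (Packet k n × Packet k n) X) _ _).comp computable_arg
  refine computable_tag_cond computable_tag 3 (Computable.const _) ?_
  refine computable_tag_cond computable_tag 4 ?_ ?_
  · exact h.compose _ (get computable_arg_left) (get computable_arg_right)
  refine computable_tag_cond computable_tag 5 ?_ ?_
  · exact h.scale computable_arg_left (get computable_arg_right)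
  refine computable_tag_cond computable_tag 6 ?_ ?_
  · exact h.sup (get computable_arg_left) (get computable_arg_right)
  · exact h.star _ (get computable_arg)

end PolicyCodes

/-! ### Routes with numbered weights -/

/-- Routes whose weights are represented by numbers. -/
def codedRoutes (P : Type*) (z e : ℕ) (le : ℕ → ℕ → Bool) (mul : ℕ → ℕ → ℕ) :
    RouteOps P ℕ (ℕ × List P) where
  zero := (z, [])
  one := (e, [])
  mark π := (e, [π])
  weight r := (r, [])
  add a b := bif le a.1 b.1 then b else a
  mul a b := (mul a.1 b.1, b.2 ++ a.2)

theorem isComputable_codedRoutes {P : Type*} [Primcodable P] (z e : ℕ)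
    {le : ℕ → ℕ → Bool} {mul : ℕ → ℕ → ℕ} (hle : Computable₂ le) (hmul : Computable₂ mul) :
    (codedRoutes P z e le mul).IsComputable where
  weight := Computable.pair Computable.id (Computable.const _)
  add := Computable.cond (hle.comp (Computable.fst.comp Computable.fst)
    (Computable.fst.comp Computable.snd)) Computable.snd Computable.fst
  mul := Computable.pair
    (hmul.comp (Computable.fst.comp Computable.fst) (Computable.fst.comp Computable.snd))
    (Computable.list_append.comp (Computable.snd.comp Computable.snd)
      (Computable.snd.comp Computable.fst))

/-- Only agreement on codes of elements of `S` is needed. The classical comparison and the Boolean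
test then select the same candidate. -/
theorem isHom_codedRoutes {S P : Type*} [OmegaContinuousSemiring S] {enc : S → ℕ}
    {le : ℕ → ℕ → Bool} {mul : ℕ → ℕ → ℕ}
    (hle : ∀ s t : S, le (enc s) (enc t) = true ↔ s ≤ t)
    (hmul : ∀ s t : S, mul (enc s) (enc t) = enc (s * t)) :
    RouteOps.IsHom (weightedRoutes S P) (codedRoutes P (enc 0) (enc 1) le mul) enc
      (Prod.map enc id) where
  zero := rfl
  one := rfl
  mark _ := rfl
  weight _ := rfl
  add a b := by
    by_cases h : a.1 ≤ b.1
    · simp [weightedRoutes, codedRoutes, h, (hle _ _).2 h]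
    · have h' : le (enc a.1) (enc b.1) = false := by
        rw [← Bool.not_eq_true, hle]; exact h
      simp [weightedRoutes, codedRoutes, h, h']
  mul a b := by simp [weightedRoutes, codedRoutes, hmul]

/-! ### Search for a witness -/

section Search

variable {P : Type*}

/-- The first listed pair of end points joined by a route of weight at least `r`. -/
def findRoute (le : ℕ → ℕ → Bool) (T : Table (P × P) (ℕ × List P)) (r : ℕ) :
    List (P × P) → Option (P × (P × List P))
  | [] => none
  | e :: l => bif le r (T e).1 then some (e.1, (e.2, (T e).2)) else findRoute le T r l

theorem computable_findRoute {β : Type*} [Primcodable β] [Primcodable P] [Fintype P]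
    {le : ℕ → ℕ → Bool} (hle : Computable₂ le) {T : β → Table (P × P) (ℕ × List P)}
    (hT : Computable T) {r : β → ℕ} (hr : Computable r) (l : List (P × P)) :
    Computable fun b => findRoute le (T b) (r b) l := by
  induction l with
  | nil => exact Computable.const _
  | cons e l ih =>
    have he := Table.computable_apply hT e
    exact Computable.cond (hle.comp hr (Computable.fst.comp he))
      (Computable.option_some.comp (Computable.pair (Computable.const _)
        (Computable.pair (Computable.const _) (Computable.snd.comp he)))) ih

theorem findRoute_eq_some {le : ℕ → ℕ → Bool} {T : Table (P × P) (ℕ × List P)} {r : ℕ}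
    {l : List (P × P)} {i j : P} {u : List P} (h : findRoute le T r l = some (i, (j, u))) :
    le r (T (i, j)).1 = true ∧ (T (i, j)).2 = u := by
  induction l with
  | nil => simp [findRoute] at h
  | cons e l ih =>
    cases he : le r (T e).1 with
    | false => exact ih (by simpa [findRoute, he] using h)
    | true =>
      simp only [findRoute, he, cond_true, Option.some.injEq, Prod.mk.injEq] at h
      obtain ⟨rfl, rfl, rfl⟩ := h
      exact ⟨he, rfl⟩

theorem isSome_findRoute {le : ℕ → ℕ → Bool} {T : Table (P × P) (ℕ × List P)} {r : ℕ}
    {l : List (P × P)} {e : P × P} (he : e ∈ l) (h : le r (T e).1 = true) :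
    (findRoute le T r l).isSome = true := by
  induction l with
  | nil => simp at he
  | cons e' l ih =>
    cases hc : le r (T e').1 with
    | true => simp [findRoute, hc]
    | false =>
      rcases List.mem_cons.1 he with rfl | he
      · simp [h] at hc
      · simpa [findRoute, hc] using ih he

end Search

end WNetKAT

/-! ### Decision procedure and witnesses -/

theorem mainTheorem2 {S : Type*} [WNetKAT.OmegaContinuousSemiring S]
    (enc : S → ℕ) (hS : WNetKAT.IsComputable enc)
    (hmul : ∀ s₁ s₂ : S, s₁ * s₂ ≤ s₁)
    (hadd : ∀ s₁ s₂ s₃ : S, s₃ ≤ s₁ + s₂ ↔ s₃ ≤ s₁ ∨ s₃ ≤ s₂)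
    (k n : ℕ) :
    (∃ D : ℕ → ℕ → Bool, Computable₂ D ∧
      ∀ (p : WNetKAT.Policy S k n) (r : S),
        D (p.code enc) (enc r) = true ↔ p.Reachable r) ∧
    (∃ W : ℕ → ℕ → Option (WNetKAT.Packet k n × WNetKAT.History k n), Computable₂ W ∧
      ∀ (p : WNetKAT.Policy S k n) (r : S), p.Reachable r →
        ∃ (π : WNetKAT.Packet k n) (h : WNetKAT.History k n),
          W (p.code enc) (enc r) = some (π, h) ∧ r ≤ p.denote (π, []) h) := by
  open WNetKAT in
  obtain ⟨mul, hmulc, hmule⟩ := hS.mul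
  obtain ⟨le, hlec, hlee⟩ := hS.order
  have hom := isHom_codedRoutes (P := Packet k n) hlee hmule
  have hT := computable_courseRec (computable_policyStep
    (isComputable_codedRoutes (P := Packet k n) (enc 0) (enc 1) hlec hmulc))
  set T := courseRec (policyStep (codedRoutes (Packet k n) (enc 0) (enc 1) le mul)) with hTdef
  have hTp : ∀ p : Policy S k n, T (p.code enc) =
      Prod.map enc id ∘ p.routes (weightedRoutes S (Packet k n)) :=
    fun p => courseRec_policyStep hom p
  let W : ℕ → ℕ → Option (Packet k n × History k n) :=
    fun c r => findRoute le (T c) r Finset.univ.toList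
  have hW : Computable₂ W :=
    computable_findRoute hlec (hT.comp Computable.fst) Computable.snd _
  have sound : ∀ (p : Policy S k n) (r : S) π h, W (p.code enc) (enc r) = some (π, h) →
      r ≤ p.denote (π, []) h := by
    rintro p r π ⟨j, u⟩ h
    obtain ⟨h1, h2⟩ := findRoute_eq_some h
    rw [hTp] at h1 h2
    -- The start history has empty tail, so the recorded list is the entire tail of the witness.
    have h3 := p.realizes_routes hadd π j []
    rw [List.append_nil] at h3
    rw [← h2]
    exact ((hlee _ _).1 h1).trans h3
  have complete : ∀ (p : Policy S k n) (r : S), p.Reachable r →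
      (W (p.code enc) (enc r)).isSome = true := by
    rintro p r ⟨π, h, hr⟩
    -- Only the head of the target history indexes the table, so a finite search covers the
    -- infinitely many targets.
    refine isSome_findRoute (Finset.mem_toList.2 (Finset.mem_univ (π, h.1))) ?_
    rw [hTp]
    exact (hlee _ _).2 (hr.trans (p.denote_le_routes hmul hadd (π, []) h))
  refine ⟨⟨fun c r => (W c r).isSome, Primrec.option_isSome.to_comp.comp hW, fun p r =>
    ⟨fun h => ?_, complete p r⟩⟩, W, hW, fun p r h => ?_⟩
  · obtain ⟨⟨π, h'⟩, hπ⟩ := Option.isSome_iff_exists.1 h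
    exact ⟨π, h', sound p r π h' hπ⟩
  · obtain ⟨⟨π, h'⟩, hπ⟩ := Option.isSome_iff_exists.1 (complete p r h)
    exact ⟨π, h', hπ, sound p r π h' hπ⟩
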